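/- Let $K \ge 2$ and let $L_1 \ge L_2 \ge \dots \ge L_K \ge 1$ be integers. For $\nu > 0$ let $(X_t)_{t\ge 0}$ be the continuous-time Markov process on the star-shaped state space $$\Omega = \{0\} \cup \{(k,l) : 1 \le k \le K,\ 1 \le l \le L_k\}$$ with transition rates $q(0,(k,1)) = L_k\nu$, $q((k,l),(k,l+1)) = (L_k-l)\nu$ for $1\le l\le L_k-1$, $q((k,1),0)=1$, $q((k,l),(k,l-1)) = l$ for $2\le l\le L_k$, and all other rates between distinct states equal to $0$. (It is the aggregated activity process of a CSMA network whose interference graph is complete $K$-partite with components of sizes $L_1,\dots,L_K$ and whose nodes activate at rate $\nu$.) Its stationary distribution is $$\pi_0 = \Big(1+\sum_{k=1}^K\sum_{l=1}^{L_k}\binom{L_k}{l}\nu^l\Big)^{-1},\qquad \pi_{(k,l)} = \pi_0\binom{L_k}{l}\nu^l .$$ For $S\subseteq\Omega$ let $\Phi(S) = \big(\sum_{x\in S,\,y\notin S}\pi_x\, q(x,y)\big)\big/\sum_{x\in S}\pi_x$ be the conductance of $S$, let $\mathcal C_2 = \{(2,l) : 1\le l\le L_2\}$ be the branch of the second-largest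 component, and let $$t_{\rm mix}(\varepsilon,\nu) = \inf\Big\{t\ge 0 : \max_{x\in\Omega}\max_{A\subseteq\Omega}\big|\mathbb P(X_t\in A \mid X_0=x)-\pi(A)\big|\le\varepsilon\Big\}$$ be the mixing time. Then $$\Phi(\mathcal C_2)\sim L_2\,\nu^{1-L_2}\qquad(\nu\to\infty),$$ i.e. the ratio of the two sides tends to $1$, and for every $\varepsilon\in(0,\tfrac14)$ there is $\nu_0$ such that for all $\nu\ge\nu_0$ $$t_{\rm mix}(\varepsilon,\nu)\ \ge\ \Big(\tfrac12-2\varepsilon\Big)\frac1{L_2}\,\nu^{L_2-1}.$$ -/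

import Mathlib

open Filter Asymptotics
open scoped NNReal ENNReal

namespace FiniteMarkov

variable {S : Type*} [Fintype S] [DecidableEq S]

/-- The generator matrix with off-diagonal entries `q x y` and zero row sums
(the values `q x x` play no role). -/
def generator (q : S → S → ℝ) : Matrix S S ℝ := fun x y =>
  if x = y then -∑ z ∈ Finset.univ.erase x, q x z else q x y

/-- The transition function of the continuous-time Markov process on the finite set `S` with
transition rates `q`: `transition q t x y` is the probability of being in `y` at time `t` when
started from `x`, that is, the `(x, y)` entry of `exp (t Q)` with `Q` the generator. -/
noncomputable def transition (q : S → S → ℝ) (t : ℝ) : Matrix S S ℝ :=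
  NormedSpace.exp (t • generator q)

/-- Total variation distance `max_A |μ(A) - ρ(A)|` of two distributions on a finite set. -/
noncomputable def tvDist (μ ρ : S → ℝ) : ℝ :=
  ⨆ A : Finset S, |∑ x ∈ A, μ x - ∑ x ∈ A, ρ x|

/-- `d(t)`: the maximum over the starting states of the total variation distance between the
law at time `t` and `π`. -/
noncomputable def maxDist (q : S → S → ℝ) (π : S → ℝ) (t : ℝ) : ℝ :=
  ⨆ x : S, tvDist (transition q t x) π

/-- The mixing time `inf {t ≥ 0 : d(t) ≤ ε}` (an infimum in `[0, ∞]`). -/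
noncomputable def mixingTime (q : S → S → ℝ) (π : S → ℝ) (ε : ℝ) : ℝ≥0∞ :=
  ⨅ (t : ℝ≥0) (_ : maxDist q π t ≤ ε), (t : ℝ≥0∞)

/-- The flow rate `Q(A, Aᶜ)` out of `A`. -/
def flowOut (q : S → S → ℝ) (π : S → ℝ) (A : Finset S) : ℝ :=
  ∑ x ∈ A, ∑ y ∈ Aᶜ, π x * q x y

/-- The conductance `Φ(A) = Q(A, Aᶜ) / π(A)`. -/
noncomputable def conductance (q : S → S → ℝ) (π : S → ℝ) (A : Finset S) : ℝ :=
  flowOut q π A / ∑ x ∈ A, π x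

end FiniteMarkov

namespace CSMA

/-- The star-shaped state space of the aggregated activity process for the complete `K`-partite
interference graph with component sizes `L k`. `none` is the center state (no active node);
`some ⟨k, i⟩` is the state in which exactly `i + 1` nodes of component `k` are active
(so the number of active nodes runs over `1, …, L k`). -/
abbrev State {K : ℕ} (L : Fin K → ℕ) : Type := Option ((k : Fin K) × Fin (L k))

/-- Transition rates at activation rate `ν`: from the center to `(k, 1)` at rate `L k * ν`, from
`(k, l)` to `(k, l + 1)` at rate `(L k - l) * ν`, from `(k, l)` one step towards the center at
rate `l`. -/
def rate {K : ℕ} (L : Fin K → ℕ) (ν : ℝ) : State L → State L → ℝ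
  | none, none => 0
  | none, some ⟨k, i⟩ => if (i : ℕ) = 0 then (L k : ℝ) * ν else 0
  | some ⟨_, i⟩, none => if (i : ℕ) = 0 then 1 else 0
  | some ⟨k, i⟩, some ⟨k', j⟩ =>
      if k = k' then
        if (j : ℕ) = i + 1 then ((L k : ℝ) - ((i : ℝ) + 1)) * ν
        else if (i : ℕ) = j + 1 then (i : ℝ) + 1
        else 0
      else 0

/-- The stationary probability of the center state. -/
noncomputable def statCenter {K : ℕ} (L : Fin K → ℕ) (ν : ℝ) : ℝ :=
  (1 + ∑ k : Fin K, ∑ l ∈ Finset.Icc 1 (L k), ((L k).choose l : ℝ) * ν ^ l)⁻¹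

/-- The stationary distribution of the aggregated activity process. -/
noncomputable def stat {K : ℕ} (L : Fin K → ℕ) (ν : ℝ) : State L → ℝ
  | none => statCenter L ν
  | some ⟨k, i⟩ => statCenter L ν * ((L k).choose ((i : ℕ) + 1) : ℝ) * ν ^ ((i : ℕ) + 1)

/-- The set of states in which some node of component `k` is active. -/
def component {K : ℕ} (L : Fin K → ℕ) (k : Fin K) : Finset (State L) :=
  Finset.univ.image fun i : Fin (L k) => some ⟨k, i⟩

/-- The conductance of (the branch of) component `k` at activation rate `ν`. -/
noncomputable def componentConductance {K : ℕ} (L : Fin K → ℕ) (k : Fin K) (ν : ℝ) : ℝ :=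
  FiniteMarkov.conductance (rate L ν) (stat L ν) (component L k)

/-- The mixing time of the aggregated activity process at activation rate `ν`. -/
noncomputable def tmix {K : ℕ} (L : Fin K → ℕ) (ε ν : ℝ) : ℝ≥0∞ :=
  FiniteMarkov.mixingTime (rate L ν) (stat L ν) ε

end CSMA

/-! The second branch is a bottleneck. Start from `π` restricted to a set `A`: by stationarity the
law stays below `π`, so mass leaves `A` at rate at most Q(A, Aᶜ) (`sum_transition_compl_le`). But
every start puts mass at least π(Aᶜ) - d(t) on Aᶜ, so d(t) ≥ π(Aᶜ) - t Φ(A), and the mixing time is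
at least (π(Aᶜ) - ε) / Φ(A). For the second branch, the only exit is (2,1) → 0 and the mass is a
binomial sum, so Φ = L₂ν / ((ν+1)^L₂ - 1) exactly. This gives the asymptotics, and also Φ ≤
L₂ν^(1-L₂) for every ν > 0. The first branch is at least as heavy, so π(Aᶜ) ≥ 1/2. -/

namespace FiniteMarkov

variable {S : Type*} [Fintype S] [DecidableEq S]

theorem generator_diag (q : S → S → ℝ) (x : S) :
    generator q x x = -∑ z ∈ Finset.univ.erase x, q x z := by
  simp [generator]

theorem generator_of_ne (q : S → S → ℝ) {x y : S} (h : x ≠ y) : generator q x y = q x y := by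
  simp [generator, h]

theorem sum_generator (q : S → S → ℝ) (x : S) : ∑ y, generator q x y = 0 := by
  rw [← Finset.add_sum_erase _ _ (Finset.mem_univ x), generator_diag,
    Finset.sum_congr rfl fun y hy => generator_of_ne q (Finset.ne_of_mem_erase hy).symm]
  simp

/-- A distribution in detailed balance with the rates is annihilated by the generator. -/
theorem sum_mul_generator_of_reversible {q : S → S → ℝ} {π : S → ℝ}
    (h : ∀ x y, π x * q x y = π y * q y x) (y : S) : ∑ x, π x * generator q x y = 0 := by
  have hx : ∀ x, π x * generator q x y = π y * generator q y x := fun x => by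
    by_cases hxy : x = y
    · rw [hxy]
    · rw [generator_of_ne q hxy, generator_of_ne q (Ne.symm hxy), h]
  rw [Finset.sum_congr rfl fun x _ => hx x, ← Finset.mul_sum, sum_generator, mul_zero]

/-! ### Matrix exponential: derivatives and entrywise nonnegativity. -/

section Exponential

open scoped Matrix.Norms.Operator

theorem hasDerivAt_exp_smul_apply (Q : Matrix S S ℝ) (x y : S) (t : ℝ) :
    HasDerivAt (fun t : ℝ => NormedSpace.exp (t • Q) x y) ((NormedSpace.exp (t • Q) * Q) x y) t :=
  hasDerivAt_pi.1 (hasDerivAt_pi.1 (hasDerivAt_exp_smul_const (𝕂 := ℝ) Q t) x) y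

theorem hasDerivAt_exp_smul_apply' (Q : Matrix S S ℝ) (x y : S) (t : ℝ) :
    HasDerivAt (fun t : ℝ => NormedSpace.exp (t • Q) x y) ((Q * NormedSpace.exp (t • Q)) x y) t :=
  hasDerivAt_pi.1 (hasDerivAt_pi.1 (hasDerivAt_exp_smul_const' (𝕂 := ℝ) Q t) x) y

theorem exp_apply_nonneg {M : Matrix S S ℝ} (hM : ∀ x y, 0 ≤ M x y) (x y : S) :
    0 ≤ NormedSpace.exp M x y := by
  have hpow : ∀ (n : ℕ) (x y : S), 0 ≤ (M ^ n) x y := by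
    intro n
    induction n with
    | zero => intro x y; rw [pow_zero, Matrix.one_apply]; split_ifs <;> norm_num
    | succ n ih =>
      intro x y
      rw [pow_succ, Matrix.mul_apply]
      exact Finset.sum_nonneg fun z _ => mul_nonneg (ih x z) (hM z y)
  have h := NormedSpace.exp_series_hasSum_exp' (𝕂 := ℝ) M
  have h' := Pi.hasSum.1 (Pi.hasSum.1 h x) y
  exact h'.nonneg fun n => mul_nonneg (by positivity) (hpow n x y)

/-- Adding a large multiple of the identity makes all entries nonnegative and only rescales the
exponential by a positive factor. -/
theorem exp_apply_nonneg_of_offDiag {M : Matrix S S ℝ} (hM : ∀ x y, x ≠ y → 0 ≤ M x y) (x y : S) :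
    0 ≤ NormedSpace.exp M x y := by
  set c : ℝ := ∑ z, |M z z|
  have hsplit : M = (M + c • 1) + (-c) • (1 : Matrix S S ℝ) := by simp
  have hcomm : Commute (M + c • 1) ((-c) • (1 : Matrix S S ℝ)) :=
    (Commute.one_right _).smul_right _
  have hone : NormedSpace.exp ((-c) • (1 : Matrix S S ℝ)) = Real.exp (-c) • 1 := by
    rw [← Algebra.algebraMap_eq_smul_one, ← Algebra.algebraMap_eq_smul_one, Real.exp_eq_exp_ℝ]
    exact (NormedSpace.algebraMap_exp_comm (𝕂 := ℝ) (𝔸 := Matrix S S ℝ) (-c)).symm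
  rw [hsplit, Matrix.exp_add_of_commute _ _ hcomm, hone, mul_smul_comm, mul_one, Matrix.smul_apply]
  refine mul_nonneg (Real.exp_pos _).le (exp_apply_nonneg (fun u v => ?_) x y)
  by_cases huv : u = v
  · subst huv
    have h1 : |M u u| ≤ c :=
      Finset.single_le_sum (f := fun z => |M z z|) (fun z _ => abs_nonneg _) (Finset.mem_univ u)
    have h2 := neg_abs_le (M u u)
    simp only [Matrix.add_apply, Matrix.smul_apply, Matrix.one_apply_eq, smul_eq_mul, mul_one]
    linarith
  · simpa [Matrix.one_apply_ne huv] using hM u v huv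

end Exponential

/-! ### Stationarity and the conductance bound. -/

theorem transition_nonneg {q : S → S → ℝ} (hq : ∀ x y, 0 ≤ q x y) {t : ℝ} (ht : 0 ≤ t) (x y : S) :
    0 ≤ transition q t x y :=
  exp_apply_nonneg_of_offDiag (fun u v huv => by
    rw [Matrix.smul_apply, generator_of_ne q huv]; exact mul_nonneg ht (hq u v)) x y

theorem transition_zero (q : S → S → ℝ) : transition q 0 = 1 := by
  simp [transition]

/-- A distribution annihilated by the generator is stationary. -/
theorem sum_mul_transition {q : S → S → ℝ} {π : S → ℝ}
    (hπ : ∀ y, ∑ x, π x * generator q x y = 0) (t : ℝ) (y : S) :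
    ∑ x, π x * transition q t x y = π y := by
  have hd : ∀ t, HasDerivAt (fun t => ∑ x, π x * transition q t x y) 0 t := fun t => by
    have h := HasDerivAt.fun_sum (u := Finset.univ) fun x _ =>
      (hasDerivAt_exp_smul_apply' (generator q) x y t).const_mul (π x)
    refine h.congr_deriv ?_
    simp only [Matrix.mul_apply, Finset.mul_sum]
    rw [Finset.sum_comm]
    refine Finset.sum_eq_zero fun z _ => ?_
    simp only [← mul_assoc]
    rw [← Finset.sum_mul, hπ, zero_mul]
  have hc := is_const_of_deriv_eq_zero (fun t => (hd t).differentiableAt) (fun t => (hd t).deriv) t 0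
  simpa [transition_zero, Matrix.one_apply] using hc

/-- Started from `π` restricted to `A`, the mass outside `A` at time `t` is at most `t` times the
flow rate out of `A`. -/
theorem sum_transition_compl_le {q : S → S → ℝ} {π : S → ℝ} (hq : ∀ x y, 0 ≤ q x y)
    (hπ₀ : ∀ x, 0 ≤ π x) (hπ : ∀ y, ∑ x, π x * generator q x y = 0) (A : Finset S) {t : ℝ}
    (ht : 0 ≤ t) :
    ∑ x ∈ A, π x * ∑ y ∈ Aᶜ, transition q t x y ≤ t * flowOut q π A := by
  set f : ℝ → ℝ := fun t => ∑ x ∈ A, π x * ∑ y ∈ Aᶜ, transition q t x y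
  have hd : ∀ t, HasDerivAt f
      (∑ x ∈ A, π x * ∑ y ∈ Aᶜ, (transition q t * generator q) x y) t := fun t =>
    HasDerivAt.fun_sum fun x _ => (HasDerivAt.fun_sum fun y _ =>
      hasDerivAt_exp_smul_apply (generator q) x y t).const_mul (π x)
  have hf0 : f 0 = 0 := Finset.sum_eq_zero fun x hx => by
    rw [transition_zero, Finset.sum_eq_zero fun y hy => Matrix.one_apply_ne
      fun hxy : x = y => Finset.mem_compl.1 hy (hxy ▸ hx), mul_zero]
  have hbound : ∀ t, 0 ≤ t →
      ∑ x ∈ A, π x * ∑ y ∈ Aᶜ, (transition q t * generator q) x y ≤ flowOut q π A := by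
    intro t ht
    -- The law at time `t` started from `π` restricted to `A`; it is dominated by the stationary law
    -- started from all of `π`.
    set m : S → ℝ := fun z => ∑ x ∈ A, π x * transition q t x z
    have hm0 : ∀ z, 0 ≤ m z := fun z =>
      Finset.sum_nonneg fun x _ => mul_nonneg (hπ₀ x) (transition_nonneg hq ht x z)
    have hm : ∀ z, m z ≤ π z := fun z => by
      rw [← sum_mul_transition hπ t z]
      exact Finset.sum_le_sum_of_subset_of_nonneg (Finset.subset_univ A) fun x _ _ =>
        mul_nonneg (hπ₀ x) (transition_nonneg hq ht x z)
    have hrew : ∑ x ∈ A, π x * ∑ y ∈ Aᶜ, (transition q t * generator q) x y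
        = ∑ z, m z * ∑ y ∈ Aᶜ, generator q z y := by
      simp only [m, Matrix.mul_apply, Finset.sum_mul]
      rw [Finset.sum_comm (s := Finset.univ)]
      refine Finset.sum_congr rfl fun x _ => ?_
      rw [Finset.sum_comm, Finset.mul_sum]
      refine Finset.sum_congr rfl fun z _ => ?_
      rw [← Finset.mul_sum, mul_assoc]
    -- Rows sum to zero, so mass already outside `A` contributes minus its rate of return to `A`.
    have hout : ∑ z ∈ Aᶜ, m z * ∑ y ∈ Aᶜ, generator q z y ≤ 0 := by
      refine Finset.sum_nonpos fun z hz => mul_nonpos_of_nonneg_of_nonpos (hm0 z) ?_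
      have h1 := Finset.sum_add_sum_compl A fun y => generator q z y
      rw [sum_generator] at h1
      have h2 : 0 ≤ ∑ y ∈ A, generator q z y := Finset.sum_nonneg fun y hy => by
        rw [generator_of_ne q fun hzy : z = y => Finset.mem_compl.1 hz (hzy ▸ hy)]
        exact hq z y
      linarith
    have hin : ∑ z ∈ A, m z * ∑ y ∈ Aᶜ, generator q z y ≤ flowOut q π A := by
      refine Finset.sum_le_sum fun z hz => ?_
      rw [← Finset.mul_sum, Finset.sum_congr rfl fun y hy => generator_of_ne q
        fun hzy : z = y => Finset.mem_compl.1 hy (hzy ▸ hz)]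
      exact mul_le_mul_of_nonneg_right (hm z) (Finset.sum_nonneg fun y _ => hq z y)
    rw [hrew, ← Finset.sum_add_sum_compl A]
    linarith
  have hmvt := (convex_Ici (0 : ℝ)).image_sub_le_mul_sub_of_deriv_le (f := f) (C := flowOut q π A)
    (fun t _ => (hd t).continuousAt.continuousWithinAt)
    (fun t _ => (hd t).differentiableAt.differentiableWithinAt)
    (fun t hts => by
      rw [(hd t).deriv]; exact hbound t (interior_subset hts))
    0 Set.self_mem_Ici t ht ht
  rw [hf0] at hmvt
  linarith

omit [DecidableEq S] in
theorem abs_sum_sub_le_tvDist (μ ρ : S → ℝ) (A : Finset S) :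
    |∑ x ∈ A, μ x - ∑ x ∈ A, ρ x| ≤ tvDist μ ρ :=
  le_ciSup (f := fun A : Finset S => |∑ x ∈ A, μ x - ∑ x ∈ A, ρ x|)
    (Set.finite_range _).bddAbove A

theorem tvDist_le_maxDist (q : S → S → ℝ) (π : S → ℝ) (t : ℝ) (x : S) :
    tvDist (transition q t x) π ≤ maxDist q π t :=
  le_ciSup (f := fun x : S => tvDist (transition q t x) π) (Set.finite_range _).bddAbove x

/-- The conductance lower bound for the distance to stationarity. -/
theorem sub_mul_conductance_le_maxDist {q : S → S → ℝ} {π : S → ℝ} (hq : ∀ x y, 0 ≤ q x y)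
    (hπ₀ : ∀ x, 0 ≤ π x) (hπ : ∀ y, ∑ x, π x * generator q x y = 0) {A : Finset S}
    (hA : 0 < ∑ x ∈ A, π x) {t : ℝ} (ht : 0 ≤ t) :
    ∑ x ∈ Aᶜ, π x - t * conductance q π A ≤ maxDist q π t := by
  have h1 := sum_transition_compl_le hq hπ₀ hπ A ht
  -- Compare the law from each `x` with `π` on the event `Aᶜ`, then average over `A`.
  have h2 : ∀ x ∈ A, π x * (∑ y ∈ Aᶜ, π y - maxDist q π t)
      ≤ π x * ∑ y ∈ Aᶜ, transition q t x y := fun x _ => by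
    refine mul_le_mul_of_nonneg_left ?_ (hπ₀ x)
    have h3 := (abs_sum_sub_le_tvDist (transition q t x) π Aᶜ).trans (tvDist_le_maxDist q π t x)
    linarith [(abs_le.1 h3).1]
  have h4 := (Finset.sum_le_sum h2).trans h1
  rw [← Finset.sum_mul, mul_comm, ← le_div_iff₀ hA] at h4
  rw [conductance, ← mul_div_assoc]
  linarith

/-- The conductance lower bound for the mixing time. -/
theorem ofReal_div_conductance_le_mixingTime {q : S → S → ℝ} {π : S → ℝ} (hq : ∀ x y, 0 ≤ q x y)
    (hπ₀ : ∀ x, 0 ≤ π x) (hπ : ∀ y, ∑ x, π x * generator q x y = 0) {A : Finset S}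
    (hA : 0 < ∑ x ∈ A, π x) (hΦ : 0 < conductance q π A) (ε : ℝ) :
    ENNReal.ofReal ((∑ x ∈ Aᶜ, π x - ε) / conductance q π A) ≤ mixingTime q π ε := by
  refine le_iInf₂ fun t ht => ?_
  rw [← ENNReal.ofReal_coe_nnreal]
  refine ENNReal.ofReal_le_ofReal ((div_le_iff₀ hΦ).2 ?_)
  linarith [sub_mul_conductance_le_maxDist hq hπ₀ hπ hA t.coe_nonneg]

end FiniteMarkov

/-! ### The star-shaped chain: reversibility, branch mass and flow. -/

namespace CSMA

open FiniteMarkov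

variable {K : ℕ} (L : Fin K → ℕ) {ν : ℝ}

theorem rate_nonneg (hν : 0 ≤ ν) : ∀ x y : State L, 0 ≤ rate L ν x y
  | none, none => le_rfl
  | none, some ⟨k, i⟩ => by simp only [rate]; split_ifs <;> positivity
  | some ⟨k, i⟩, none => by simp only [rate]; split_ifs <;> norm_num
  | some ⟨k, i⟩, some ⟨k', j⟩ => by
    have hi : (i : ℝ) + 1 ≤ L k := by exact_mod_cast i.2
    simp only [rate]
    split_ifs
    · exact mul_nonneg (by linarith) hν
    · positivity
    · exact le_rfl
    · exact le_rfl

theorem statCenter_pos (hν : 0 ≤ ν) : 0 < statCenter L ν := by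
  rw [statCenter]; positivity

theorem stat_nonneg (hν : 0 ≤ ν) : ∀ x : State L, 0 ≤ stat L ν x
  | none => (statCenter_pos L hν).le
  | some ⟨k, i⟩ => by
    have := (statCenter_pos L hν).le
    simp only [stat]; positivity

/-- Detailed balance along a branch is (l+1)·C(n,l+1) = (n-l)·C(n,l) with l = i + 1; for l > n both
binomials vanish. -/
theorem stat_mul_rate_succ (n i : ℕ) (c : ℝ) :
    c * (n.choose (i + 1) : ℝ) * ν ^ (i + 1) * (((n : ℝ) - ((i : ℝ) + 1)) * ν)
      = c * (n.choose (i + 1 + 1) : ℝ) * ν ^ (i + 1 + 1) * (((i + 1 : ℕ) : ℝ) + 1) := by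
  have h : (n.choose (i + 1 + 1) : ℝ) * (((i + 1 : ℕ) : ℝ) + 1)
      = n.choose (i + 1) * ((n : ℝ) - ((i : ℝ) + 1)) := by
    rcases le_or_gt (i + 1) n with hin | hin
    · have := Nat.choose_succ_right_eq n (i + 1)
      have h2 : ((n - (i + 1) : ℕ) : ℝ) = (n : ℝ) - ((i : ℝ) + 1) := by
        rw [Nat.cast_sub hin]; push_cast; ring
      rw [← h2]
      exact_mod_cast this
    · rw [Nat.choose_eq_zero_of_lt hin, Nat.choose_eq_zero_of_lt (by omega)]; simp
  rw [pow_succ ν (i + 1)]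
  linear_combination (-c * ν ^ (i + 1) * ν) * h

/-- Detailed balance. -/
theorem stat_mul_rate_comm : ∀ x y : State L,
    stat L ν x * rate L ν x y = stat L ν y * rate L ν y x
  | none, none => rfl
  | none, some ⟨k, i⟩ => by
    simp only [rate, stat]
    split_ifs with h
    · simp [h]; ring
    · simp
  | some ⟨k, i⟩, none => by
    simp only [rate, stat]
    split_ifs with h
    · simp [h]; ring
    · simp
  | some ⟨k, i⟩, some ⟨k', j⟩ => by
    by_cases hk : k = k'
    · subst hk
      simp only [rate, stat, if_true]
      by_cases h1 : (j : ℕ) = i + 1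
      · rw [if_pos h1, if_neg (by omega), if_pos h1, h1]
        exact stat_mul_rate_succ (L k) i _
      · by_cases h2 : (i : ℕ) = j + 1
        · rw [if_neg h1, if_pos h2, if_pos h2, h2]
          exact (stat_mul_rate_succ (L k) j _).symm
        · rw [if_neg h1, if_neg h2, if_neg h2, if_neg h1, mul_zero, mul_zero]
    · simp [rate, hk, Ne.symm hk]

theorem sum_component {f : State L → ℝ} (k : Fin K) :
    ∑ x ∈ component L k, f x = ∑ i : Fin (L k), f (some ⟨k, i⟩) := by
  rw [component, Finset.sum_image]
  intro i _ j _ h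
  simpa using h

theorem sum_choose_mul_pow (n : ℕ) :
    ∑ i ∈ Finset.range n, (n.choose (i + 1) : ℝ) * ν ^ (i + 1) = (ν + 1) ^ n - 1 := by
  rw [add_pow, Finset.sum_range_succ']
  simp [mul_comm]

theorem sum_stat_component (k : Fin K) :
    ∑ x ∈ component L k, stat L ν x = statCenter L ν * ((ν + 1) ^ L k - 1) := by
  rw [sum_component, ← sum_choose_mul_pow, Finset.mul_sum, ← Fin.sum_univ_eq_sum_range
    (fun i => statCenter L ν * (((L k).choose (i + 1) : ℝ) * ν ^ (i + 1)))]
  exact Finset.sum_congr rfl fun i _ => mul_assoc _ _ _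

theorem statCenter_eq : statCenter L ν = (1 + ∑ k, ((ν + 1) ^ L k - 1))⁻¹ := by
  rw [statCenter]
  congr 2
  refine Finset.sum_congr rfl fun k _ => ?_
  rw [← sum_choose_mul_pow, Finset.range_eq_Ico,
    Finset.sum_Ico_add' (fun l => ((L k).choose l : ℝ) * ν ^ l) 0 (L k) 1]
  rfl

theorem sum_stat (hν : 0 ≤ ν) : ∑ x, stat L ν x = 1 := by
  have h := statCenter_pos L hν
  rw [Fintype.sum_option, Fintype.sum_sigma]
  simp only [← sum_component, sum_stat_component]
  rw [← Finset.mul_sum, show stat L ν none = statCenter L ν from rfl]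
  rw [statCenter_eq] at h ⊢
  have := inv_pos.1 h
  field_simp

theorem mem_component {k : Fin K} {x : State L} :
    x ∈ component L k ↔ ∃ i, some ⟨k, i⟩ = x := by
  simp [component]

theorem flowOut_component {k : Fin K} (hk : 1 ≤ L k) :
    flowOut (rate L ν) (stat L ν) (component L k) = statCenter L ν * (L k * ν) := by
  have hinner : ∀ i : Fin (L k), ∑ y ∈ (component L k)ᶜ, stat L ν (some ⟨k, i⟩) *
      rate L ν (some ⟨k, i⟩) y = stat L ν (some ⟨k, i⟩) * rate L ν (some ⟨k, i⟩) none := by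
    intro i
    -- Distinct branches communicate only through the center.
    refine Finset.sum_eq_single_of_mem none (by simp [mem_component]) fun y hy hy0 => ?_
    rw [Finset.mem_compl, mem_component] at hy
    obtain _ | ⟨k', j⟩ := y
    · exact absurd rfl hy0
    · have hkk : k ≠ k' := by
        rintro rfl; exact hy ⟨j, rfl⟩
      simp [rate, hkk]
  rw [flowOut, sum_component, Finset.sum_congr rfl fun i _ => hinner i,
    Finset.sum_eq_single_of_mem (⟨0, hk⟩ : Fin (L k)) (Finset.mem_univ _)]
  · simp [rate, stat]; ring
  · intro i _ hi
    have : (i : ℕ) ≠ 0 := fun h => hi (Fin.ext h)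
    simp [rate, this]

theorem componentConductance_eq {k : Fin K} (hk : 1 ≤ L k) (hν : 0 ≤ ν) :
    componentConductance L k ν = L k * ν / ((ν + 1) ^ L k - 1) := by
  rw [componentConductance, conductance, flowOut_component L hk, sum_stat_component,
    mul_div_mul_left _ _ (statCenter_pos L hν).ne']

/-- Superadditivity of the n-th power; it makes the mixing bound hold at every positive ν, not only
in the limit. -/
theorem pow_le_add_one_pow_sub_one {n : ℕ} (hn : 1 ≤ n) (hν : 0 ≤ ν) :
    ν ^ n ≤ (ν + 1) ^ n - 1 := by
  have := pow_add_pow_le hν zero_le_one (Nat.one_le_iff_ne_zero.1 hn)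
  rw [one_pow] at this
  linarith

theorem isEquivalent_add_one_pow_sub_one {n : ℕ} (hn : 1 ≤ n) :
    (fun ν : ℝ => (ν + 1) ^ n - 1) ~[atTop] fun ν : ℝ => ν ^ n := by
  have h : (fun ν : ℝ => ν + 1) ~[atTop] fun ν : ℝ => ν :=
    IsEquivalent.refl.add_isLittleO (isLittleO_const_id_atTop 1)
  refine (h.pow n).sub_isLittleO (isLittleO_const_left.2 (Or.inr ?_))
  exact tendsto_norm_atTop_atTop.comp (tendsto_pow_atTop (Nat.one_le_iff_ne_zero.1 hn))

/-- A component that is not larger than another one carries at most half of the mass. -/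
theorem half_le_sum_stat_compl_component {k k' : Fin K} (hkk' : k ≠ k') (hL : L k ≤ L k')
    (hν : 0 ≤ ν) : 1 / 2 ≤ ∑ x ∈ (component L k)ᶜ, stat L ν x := by
  have h1 := Finset.sum_add_sum_compl (component L k) (stat L ν)
  rw [sum_stat L hν] at h1
  have h2 : ∑ x ∈ component L k', stat L ν x ≤ ∑ x ∈ (component L k)ᶜ, stat L ν x := by
    refine Finset.sum_le_sum_of_subset_of_nonneg (fun x hx => ?_) fun x _ _ => stat_nonneg L hν x
    rw [mem_component] at hx
    obtain ⟨i, rfl⟩ := hx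
    rw [Finset.mem_compl, mem_component]
    rintro ⟨j, hj⟩
    simp only [Option.some.injEq, Sigma.mk.injEq] at hj
    exact hkk' hj.1
  have h3 : ∑ x ∈ component L k, stat L ν x ≤ ∑ x ∈ component L k', stat L ν x := by
    rw [sum_stat_component, sum_stat_component]
    have := (statCenter_pos L hν).le
    gcongr
    linarith
  linarith

end CSMA

/-! ### Conclusion. -/

theorem mainTheorem12 {K : ℕ} (hK : 2 ≤ K) (L : Fin K → ℕ) (hpos : ∀ k, 1 ≤ L k)
    (hL : Antitone L) (k₂ : Fin K) (hk₂ : (k₂ : ℕ) = 1) :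
    ((fun ν : ℝ => CSMA.componentConductance L k₂ ν) ~[atTop]
        fun ν : ℝ => (L k₂ : ℝ) * ν ^ (1 - (L k₂ : ℤ))) ∧
      ∀ ε : ℝ, 0 < ε → ε < 1 / 4 → ∀ᶠ ν : ℝ in atTop,
        ENNReal.ofReal ((1 / 2 - 2 * ε) * (1 / (L k₂ : ℝ)) * ν ^ ((L k₂ : ℤ) - 1)) ≤
          CSMA.tmix L ε ν := by
  constructor
  · have h1 : (fun ν : ℝ => (L k₂ : ℝ) * ν / ((ν + 1) ^ L k₂ - 1)) ~[atTop]
        fun ν : ℝ => (L k₂ : ℝ) * ν / ν ^ L k₂ :=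
      IsEquivalent.refl.div (CSMA.isEquivalent_add_one_pow_sub_one (hpos k₂))
    refine (h1.congr_left ?_).congr_right ?_
    · filter_upwards [eventually_ge_atTop 0] with ν hν
      rw [CSMA.componentConductance_eq L (hpos k₂) hν]
    · filter_upwards [eventually_gt_atTop 0] with ν hν
      rw [zpow_sub₀ hν.ne', zpow_one, zpow_natCast, mul_div_assoc]
  · intro ε hε hε'
    filter_upwards [eventually_gt_atTop 0] with ν hν
    have hLpos : (0 : ℝ) < L k₂ := by exact_mod_cast hpos k₂
    have hpow := CSMA.pow_le_add_one_pow_sub_one (hpos k₂) hν.le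
    have hmass : 0 < (ν + 1) ^ L k₂ - 1 := (pow_pos hν _).trans_le hpow
    have hΦ : CSMA.componentConductance L k₂ ν = L k₂ * ν / ((ν + 1) ^ L k₂ - 1) :=
      CSMA.componentConductance_eq L (hpos k₂) hν.le
    have hhalf : 1 / 2 ≤ ∑ x ∈ (CSMA.component L k₂)ᶜ, CSMA.stat L ν x := by
      let k₁ : Fin K := ⟨0, by omega⟩
      refine CSMA.half_le_sum_stat_compl_component L (k' := k₁) (fun h => ?_) (hL ?_) hν.le
      · simp [h, k₁] at hk₂
      · exact Fin.mk_le_of_le_val (Nat.zero_le _)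
    have hmix := FiniteMarkov.ofReal_div_conductance_le_mixingTime (A := CSMA.component L k₂)
      (CSMA.rate_nonneg L hν.le) (CSMA.stat_nonneg L hν.le)
      (FiniteMarkov.sum_mul_generator_of_reversible (CSMA.stat_mul_rate_comm L))
      (by rw [CSMA.sum_stat_component]; exact mul_pos (CSMA.statCenter_pos L hν.le) hmass)
      (by rw [← CSMA.componentConductance, hΦ]; positivity) ε
    refine le_trans (ENNReal.ofReal_le_ofReal ?_) hmix
    rw [← CSMA.componentConductance, hΦ, zpow_sub₀ hν.ne', zpow_one, zpow_natCast, div_div_eq_mul_div]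
    calc (1 / 2 - 2 * ε) * (1 / (L k₂ : ℝ)) * (ν ^ L k₂ / ν)
        = (1 / 2 - 2 * ε) * ν ^ L k₂ / (L k₂ * ν) := by field_simp
      -- Numerators compare factor by factor: 1/2 - 2ε ≤ π(Aᶜ) - ε and `hpow`.
      _ ≤ _ := by
        gcongr
        · linarith
        · linarith
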